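/- Let $R$ be a local noetherian domain of Krull dimension $1$ with maximal ideal $\mathfrak m$, and assume that its $\mathfrak m$-adic completion $\widehat R$ is reduced. Let $K(\widehat R)$ denote the total quotient ring of $\widehat R$, that is, the localization of $\widehat R$ at the set of all its non-zero-divisors. For a module $M$ over a commutative ring $A$, let $\mathrm{Add}(M)$ be the class of $A$-modules that are isomorphic to a direct summand of a direct sum of arbitrarily many copies of $M$. An $\widehat R$-module $N$ is said to be \emph{extended} from an $R$-module $X$ if $N\cong X\otimes_R\widehat R$ as $\widehat R$-modules. Let $M$ be a finitely generated torsion-free $R$-module, and put $\widehat M=M\otimes_R\widehat R$. Then for every countably generated $\widehat R$-module $N\in\mathrm{Add}(\widehat M)$ the following statements are equivalent: (i) $N$ is extended from some $R$-module; (ii) there exists a countable (possibly finite or empty) set $\Lambda$ such that $N\otimes_{\widehat R}K(\widehat R)\cong K(\widehat R)^{(\Lambda)}$ as $K(\widehat R)$-modules, where $K(\widehat R)^{(\Lambda)}$ is the direct sum of copies of $K(\widehat R)$ indexed by $\Lambda$; (iii) $N$ is extended from some countably generated $R$-module belonging to $\mathrm{Add}(M)$. -/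

import Mathlib

open scoped TensorProduct

universe u v w x

/-- The completion of a local ring `R` at its maximal ideal. -/
abbrev LocalCompletion (R : Type u) [CommRing R] [IsLocalRing R] : Type u :=
  AdicCompletion (IsLocalRing.maximalIdeal R) R

/-- An `A`-module generated by a countable (possibly finite or empty) set. -/
def IsCountablyGenerated (A : Type u) [CommRing A] (N : Type w) [AddCommGroup N] [Module A N] :
    Prop :=
  ∃ s : Set N, s.Countable ∧ Submodule.span A s = ⊤

/-- `N` belongs to `Add(M)`: it is isomorphic to a direct summand of a direct sum of copies of `M`,
over an index set of arbitrary cardinality. It is no restriction that the index type lives in the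
universe of `N`: the union of the (finite) supports of the elements of a copy of `N` inside a direct
sum of copies of `M` has at most `max |N| ℵ₀` elements, and the other summands can be discarded. -/
def MemAdd (A : Type u) [CommRing A] (M : Type v) [AddCommGroup M] [Module A M]
    (N : Type w) [AddCommGroup N] [Module A N] : Prop :=
  ∃ (ι : Type w) (P : Submodule A (ι →₀ M)), IsComplemented P ∧ Nonempty (N ≃ₗ[A] P)

/-- The module `N` over the completion of `R` is extended from the `R`-module `X`: it is isomorphic,
over the completion, to the base change of `X`. -/
def IsExtendedFrom (R : Type u) [CommRing R] [IsLocalRing R]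
    (N : Type w) [AddCommGroup N] [Module (LocalCompletion R) N]
    (X : Type v) [AddCommGroup X] [Module R X] : Prop :=
  Nonempty (N ≃ₗ[LocalCompletion R] (LocalCompletion R ⊗[R] X))

/-!
Write `A` for the completion of `R` and `K` for its total quotient ring.

If `N ≅ A ⊗ X`, then `K ⊗ N` is a scalar extension of the vector space `Frac R ⊗ X`, because `A` is
flat over `R` and so nonzero elements of `R` become units in `K`. Hence `K ⊗ N` is free.

Conversely, clearing denominators in a `K`-basis of `K ⊗ N` gives an `A`-independent family `e` in
`N` such that every element of `N` has a multiple in `span A e` by a nonzerodivisor of `A`. In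
dimension at most one, a nonzero `s : R` satisfies `𝔪 ^ n ≤ (s)` for some `n`. Hence
`R / s ≅ A / s`, and every nonzerodivisor of `A` divides a nonzero element of `R`. Therefore
`X = {n | s • n ∈ span R e for some s ≠ 0}` satisfies `A ⊗ X ≅ N`.

It remains to descend membership in `Add`. A finite part of an `A`-linear retraction of a power of
`A ⊗ M` onto `A ⊗ X` only involves `A`-combinations of maps `M → X`, and the existence of a section
over a finitely generated submodule is a linear condition, which descends along `R → A`. Composing
such partial sections along a chain of finitely generated submodules exhausting `X` produces a
section defined on all of `X`.
-/

section DirectSummands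

variable {A : Type*} [CommRing A] {M : Type*} [AddCommGroup M] [Module A M]

theorem memAdd_of_leftInverse {N : Type w} [AddCommGroup N] [Module A N] {ι : Type*} [Small.{w} ι]
    (i : N →ₗ[A] (ι →₀ M)) (p : (ι →₀ M) →ₗ[A] N) (h : p ∘ₗ i = LinearMap.id) :
    MemAdd A M N := by
  let E := Finsupp.domLCongr (M := M) (R := A) (equivShrink.{w} ι)
  let i' := E.toLinearMap ∘ₗ i
  have hi' : Function.LeftInverse (p ∘ₗ E.symm.toLinearMap) i' := fun x => by
    simpa [i'] using LinearMap.congr_fun h x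
  refine ⟨Shrink.{w} ι, LinearMap.range i',
    ⟨LinearMap.ker (i'.rangeRestrict ∘ₗ p ∘ₗ E.symm.toLinearMap), LinearMap.isCompl_of_proj ?_⟩,
    ⟨LinearEquiv.ofInjective i' hi'.injective⟩⟩
  rintro ⟨_, x, rfl⟩
  exact Subtype.ext (congrArg i' (hi' x))

theorem MemAdd.exists_mem_span_comp_eq_self {N : Type*} [AddCommGroup N] [Module A N]
    (h : MemAdd A M N) (F : Finset N) :
    ∃ φ ∈ Submodule.span A {φ : Module.End A N | ∃ (k : M →ₗ[A] N) (g : N →ₗ[A] M), k ∘ₗ g = φ},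
      ∀ z ∈ F, φ z = z := by
  classical
  obtain ⟨ι, P, ⟨Q, hPQ⟩, ⟨e⟩⟩ := h
  let π : (ι →₀ M) →ₗ[A] N := e.symm.toLinearMap ∘ₗ P.projectionOnto Q hPQ
  let t : Finset ι := F.biUnion fun z => (e z : ι →₀ M).support
  refine ⟨∑ j ∈ t, (π ∘ₗ Finsupp.lsingle j) ∘ₗ (Finsupp.lapply j ∘ₗ P.subtype ∘ₗ e.toLinearMap),
    sum_mem fun j _ => Submodule.subset_span ⟨_, _, rfl⟩, fun z hz => ?_⟩
  have hsupp : (e z : ι →₀ M).support ⊆ t :=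
    Finset.subset_biUnion_of_mem (fun z => (e z : ι →₀ M).support) hz
  have hsum : ∑ j ∈ t, Finsupp.single j ((e z : ι →₀ M) j) = e z := by
    rw [← Finsupp.sum_of_support_subset _ hsupp _ (by simp), Finsupp.sum_single]
  calc _ = π (∑ j ∈ t, Finsupp.single j ((e z : ι →₀ M) j)) := by simp
    _ = z := by simp [hsum, π]

end DirectSummands

section FaithfullyFlatDescent

variable {R : Type*} [CommRing R] (A : Type*) [CommRing A] [Algebra R A]
  {M X Y Z P : Type*} [AddCommGroup M] [Module R M] [AddCommGroup X] [Module R X]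
  [AddCommGroup Y] [Module R Y] [AddCommGroup Z] [Module R Z] [AddCommGroup P] [Module R P]

theorem mem_span_range_baseChangeHom [Module.Flat R A] [Module.FinitePresentation R P]
    (φ : A ⊗[R] P →ₗ[A] A ⊗[R] X) :
    φ ∈ Submodule.span A (LinearMap.range (LinearMap.baseChangeHom R A P X)) :=
  (Module.FinitePresentation.isBaseChange_map R P X A).inductionOn φ _ (zero_mem _)
    (fun f => Submodule.subset_span ⟨f, rfl⟩) (fun a _ => Submodule.smul_mem _ a)
    (fun _ _ => add_mem)

variable {A} in
theorem mem_of_mem_span_image_of_isBaseChange [Module.FaithfullyFlat R A] {X' : Type*}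
    [AddCommMonoid X'] [Module R X'] [Module A X'] [IsScalarTower R A X'] {f : X →ₗ[R] X'}
    (hf : IsBaseChange A f) (I : Submodule R X) {x : X}
    (hx : f x ∈ Submodule.span A (f '' I)) : x ∈ I := by
  let q : X' →ₗ[A] A ⊗[R] (X ⧸ I) := hf.lift (TensorProduct.mk R A (X ⧸ I) 1 ∘ₗ I.mkQ)
  have hq : ∀ y, q (f y) = 1 ⊗ₜ I.mkQ y := fun y => hf.lift_eq _ y
  have hI : Submodule.span A (f '' I) ≤ LinearMap.ker q := by
    rw [Submodule.span_le]
    rintro _ ⟨y, hy, rfl⟩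
    simp [hq, (Submodule.Quotient.mk_eq_zero I).2 hy]
  rw [← Submodule.Quotient.mk_eq_zero,
    ← Module.FaithfullyFlat.one_tmul_eq_zero_iff R (X ⧸ I) (A := A)]
  exact (hq x).symm.trans (hI hx)

theorem exists_comp_comp_eq_of_baseChange [Module.FaithfullyFlat R A]
    [Module.FinitePresentation R Y] [Module.FinitePresentation R Z]
    {i : Y →ₗ[R] Z} {p : P →ₗ[R] X} {f : Y →ₗ[R] X} (g : A ⊗[R] Z →ₗ[A] A ⊗[R] P)
    (hg : p.baseChange A ∘ₗ g ∘ₗ i.baseChange A = f.baseChange A) :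
    ∃ g : Z →ₗ[R] P, p ∘ₗ g ∘ₗ i = f := by
  obtain ⟨D, hD⟩ : ∃ D : (Z →ₗ[R] P) →ₗ[R] (Y →ₗ[R] X), ∀ g, D g = p ∘ₗ g ∘ₗ i :=
    ⟨LinearMap.compRight R p ∘ₗ LinearMap.lcomp R P i, fun _ => rfl⟩
  obtain ⟨D', hD'⟩ : ∃ D' : (A ⊗[R] Z →ₗ[A] A ⊗[R] P) →ₗ[A] (A ⊗[R] Y →ₗ[A] A ⊗[R] X),
      ∀ g, D' g = p.baseChange A ∘ₗ g ∘ₗ i.baseChange A :=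
    ⟨LinearMap.compRight A (p.baseChange A) ∘ₗ LinearMap.lcomp A _ (i.baseChange A), fun _ => rfl⟩
  have hspan : (Submodule.span A (LinearMap.range (LinearMap.baseChangeHom R A Z P))).map D' ≤
      Submodule.span A (LinearMap.baseChangeHom R A Y X '' LinearMap.range D) := by
    rw [Submodule.map_span_le]
    rintro _ ⟨k, rfl⟩
    refine Submodule.subset_span ⟨D k, ⟨k, rfl⟩, ?_⟩
    simp [hD, hD', LinearMap.baseChange_comp]
  obtain ⟨g, hg⟩ := mem_of_mem_span_image_of_isBaseChange
    (Module.FinitePresentation.isBaseChange_map R Y X A) (LinearMap.range D)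
    (hspan ⟨g, mem_span_range_baseChangeHom A g, (hD' g).trans hg⟩)
  exact ⟨g, (hD g).symm.trans hg⟩

theorem MemAdd.exists_mem_span_baseChange_comp_eq_self [Module.Flat R A]
    [Module.FinitePresentation R M] {N : Type*} [AddCommGroup N] [Module A N]
    (hN : MemAdd A (A ⊗[R] M) N) (ψ : N ≃ₗ[A] A ⊗[R] X) (F : Finset (A ⊗[R] X)) :
    ∃ φ ∈ Submodule.span A {φ : Module.End A (A ⊗[R] X) |
        ∃ (k : M →ₗ[R] X) (g : A ⊗[R] X →ₗ[A] A ⊗[R] M), k.baseChange A ∘ₗ g = φ},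
      ∀ z ∈ F, φ z = z := by
  classical
  obtain ⟨φ, hφ, hφF⟩ := hN.exists_mem_span_comp_eq_self (F.image ψ.symm)
  refine ⟨ψ.conj φ, (Submodule.map_span_le ψ.conj.toLinearMap _ _).2 ?_ ⟨φ, hφ, rfl⟩,
    fun z hz => ?_⟩
  · rintro _ ⟨k, g, rfl⟩
    let precomp := LinearMap.lcomp A (A ⊗[R] X) (g ∘ₗ ψ.symm.toLinearMap)
    refine (Submodule.map_span_le precomp _ _).2 ?_
      ⟨_, mem_span_range_baseChangeHom A (ψ.toLinearMap ∘ₗ k), rfl⟩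
    rintro _ ⟨k, rfl⟩
    exact Submodule.subset_span ⟨k, _, rfl⟩
  · simpa [LinearEquiv.conj_apply] using congrArg ψ (hφF _ (Finset.mem_image_of_mem _ hz))

theorem MemAdd.exists_factorization_of_baseChange [Module.Flat R A]
    [Module.FinitePresentation R M] {N : Type*} [AddCommGroup N] [Module A N]
    (hN : MemAdd A (A ⊗[R] M) N) (ψ : N ≃ₗ[A] A ⊗[R] X) {Y : Submodule R X} (hY : Y.FG) :
    ∃ (n : ℕ) (p : (Fin n →₀ M) →ₗ[R] X) (g : A ⊗[R] X →ₗ[A] A ⊗[R] (Fin n →₀ M)),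
      p.baseChange A ∘ₗ g ∘ₗ Y.subtype.baseChange A = Y.subtype.baseChange A := by
  classical
  obtain ⟨F, rfl⟩ := hY
  obtain ⟨φ, hφ, hφF⟩ := hN.exists_mem_span_baseChange_comp_eq_self A ψ (F.image (1 ⊗ₜ ·))
  obtain ⟨n, a, b, rfl⟩ := Submodule.mem_span_set'.1 hφ
  choose k g hkg using fun j => (b j).2
  refine ⟨n, Finsupp.lsum R k, ∑ j, a j • ((Finsupp.lsingle j).baseChange A ∘ₗ g j), ?_⟩
  have hfactor : (Finsupp.lsum R k).baseChange A ∘ₗ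
      (∑ j, a j • ((Finsupp.lsingle j).baseChange A ∘ₗ g j)) = ∑ j, a j • (b j).1 := by
    refine (map_sum (LinearMap.compRight A ((Finsupp.lsum R k).baseChange A)) _ _).trans
      (Finset.sum_congr rfl fun j _ => ?_)
    rw [map_smul, LinearMap.compRight_apply, ← LinearMap.comp_assoc, ← LinearMap.baseChange_comp,
      Finsupp.lsum_comp_lsingle, hkg]
  have hfix : (Submodule.span R (F : Set X)) ≤
      LinearMap.eqLocus ((∑ j, a j • (b j).1).restrictScalars R ∘ₗ TensorProduct.mk R A X 1)
        (TensorProduct.mk R A X 1) :=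
    Submodule.span_le.2 fun y hy => hφF _ (Finset.mem_image_of_mem _ hy)
  rw [← LinearMap.comp_assoc, hfactor]
  ext y
  exact hfix y.2

end FaithfullyFlatDescent

section CountablyGenerated

variable {A : Type*} [CommRing A] {N : Type*} [AddCommGroup N] [Module A N]

theorem IsCountablyGenerated.exists_span_range_eq_top (h : IsCountablyGenerated A N) :
    ∃ s : ℕ → N, Submodule.span A (Set.range s) = ⊤ := by
  obtain ⟨s, hs, hspan⟩ := h
  obtain ⟨f, hf⟩ := (hs.insert 0).exists_eq_range (Set.insert_nonempty 0 s)
  exact ⟨f, by rw [← hf, Submodule.span_insert_zero, hspan]⟩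

theorem IsCountablyGenerated.of_surjective {P : Type*} [AddCommGroup P] [Module A P]
    (h : IsCountablyGenerated A N) (f : N →ₗ[A] P) (hf : Function.Surjective f) :
    IsCountablyGenerated A P := by
  obtain ⟨s, hs, hspan⟩ := h
  refine ⟨f '' s, hs.image _, ?_⟩
  rw [Submodule.span_image, hspan, Submodule.map_top, LinearMap.range_eq_top.2 hf]

theorem IsCountablyGenerated.baseChange (h : IsCountablyGenerated A N) (K : Type*) [CommRing K]
    [Algebra A K] : IsCountablyGenerated K (K ⊗[A] N) := by
  obtain ⟨s, hs, hspan⟩ := h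
  refine ⟨TensorProduct.mk A K N 1 '' s, hs.image _, ?_⟩
  rw [← Submodule.baseChange_span, hspan, Submodule.baseChange_top]

theorem IsCountablyGenerated.of_baseChange (K : Type*) [CommRing K] [Algebra A K]
    [Module.FaithfullyFlat A K] (h : IsCountablyGenerated K (K ⊗[A] N)) :
    IsCountablyGenerated A N := by
  classical
  obtain ⟨s, hs, hspan⟩ := h
  choose T hT using fun z : K ⊗[A] N => TensorProduct.exists_finset z
  let t : Set N := ⋃ z ∈ s, ((T z).image Prod.snd : Finset N)
  have ht : (⊤ : Submodule K (K ⊗[A] N)) ≤ (Submodule.span A t).baseChange K := by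
    rw [← hspan, Submodule.span_le]
    intro z hz
    rw [hT z]
    refine sum_mem fun i hi => Submodule.tmul_mem_baseChange_of_mem _ (Submodule.subset_span ?_)
    exact Set.mem_biUnion hz (Finset.mem_coe.2 (Finset.mem_image_of_mem Prod.snd hi))
  refine ⟨t, hs.biUnion fun z _ => Finset.countable_toSet _, Submodule.eq_top_iff'.2 fun x => ?_⟩
  refine mem_of_mem_span_image_of_isBaseChange (TensorProduct.isBaseChange A N K) _ ?_
  rw [← Submodule.map_coe, ← Submodule.baseChange_eq_span]
  exact ht Submodule.mem_top

theorem IsCountablyGenerated.exists_linearEquiv {R : Type u} [CommRing R] {X : Type*}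
    [AddCommGroup X] [Module R X] (h : IsCountablyGenerated R X) :
    ∃ (X' : Type (max u x)) (_ : AddCommGroup X') (_ : Module R X'), Nonempty (X ≃ₗ[R] X') := by
  obtain ⟨s, hs⟩ := h.exists_span_range_eq_top
  let f : (ℕ →₀ R) →ₗ[R] X := Finsupp.linearCombination R s
  have hf : Function.Surjective f := by
    rw [← LinearMap.range_eq_top, Finsupp.range_linearCombination, hs]
  exact ⟨ULift.{x} ((ℕ →₀ R) ⧸ LinearMap.ker f), inferInstance, inferInstance,
    ⟨(f.quotKerEquivOfSurjective hf).symm ≪≫ₗ ULift.moduleEquiv.symm⟩⟩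

theorem IsCountablyGenerated.countable_of_basis [Nontrivial A] (h : IsCountablyGenerated A N)
    {Λ : Type*} (b : Module.Basis Λ A N) : Countable Λ := by
  obtain ⟨s, hs, hspan⟩ := h
  let T : Set Λ := ⋃ z ∈ s, ((b.repr z).support : Set Λ)
  have hT : T.Countable := hs.biUnion fun z _ => Finset.countable_toSet _
  have hle : (⊤ : Submodule A N) ≤ (Finsupp.supported A A T).comap b.repr.toLinearMap := by
    rw [← hspan, Submodule.span_le]
    exact fun z hz => Set.subset_biUnion_of_mem (u := fun z => ((b.repr z).support : Set Λ)) hz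
  refine Set.countable_univ_iff.1 (hT.mono fun l _ => ?_)
  exact hle (Submodule.mem_top (x := b l)) (by simp)

theorem IsCountablyGenerated.exists_countable_linearEquiv_finsupp [Nontrivial A]
    [Module.Free A N] (h : IsCountablyGenerated A N) :
    ∃ Λ : Type, Countable Λ ∧ Nonempty (N ≃ₗ[A] Λ →₀ A) := by
  let b := Module.Free.chooseBasis A N
  have := h.countable_of_basis b
  let index := equivShrink.{0} (Module.Free.ChooseBasisIndex A N)
  exact ⟨_, index.symm.injective.countable, ⟨(b.reindex index).repr⟩⟩

end CountablyGenerated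

section Telescope

variable {R : Type*} [Ring R] {X : Type*} [AddCommGroup X] [Module R X]
  {Y : ℕ → Submodule R X} (hY : Monotone Y) (hex : ∀ x, ∃ n, x ∈ Y n)

include hY hex

theorem exists_linearMap_of_monotone {P : Type*} [AddCommGroup P] [Module R P]
    (θ : ∀ n, Y n →ₗ[R] P) (hθ : ∀ n, θ (n + 1) ∘ₗ Submodule.inclusion (hY n.le_succ) = θ n) :
    ∃ ψ : X →ₗ[R] P, ∀ n, ψ ∘ₗ (Y n).subtype = θ n := by
  have hle : ∀ {m n} (hmn : m ≤ n) (x : Y m), θ n (Submodule.inclusion (hY hmn) x) = θ m x := by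
    intro m n hmn x
    induction n, hmn using Nat.le_induction with
    | base => rfl
    | succ n hmn ih => rw [← ih, ← hθ n]; rfl
  choose n hn using hex
  have hagree : ∀ m x (hx : x ∈ Y m), θ (n x) ⟨x, hn x⟩ = θ m ⟨x, hx⟩ := fun m x hx =>
    (hle (le_max_left (n x) m) ⟨x, hn x⟩).symm.trans (hle (le_max_right (n x) m) ⟨x, hx⟩)
  refine ⟨{ toFun := fun x => θ (n x) ⟨x, hn x⟩, map_add' := fun x y => ?_,
            map_smul' := fun r x => ?_ }, fun m => LinearMap.ext fun x => hagree m x x.2⟩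
  · have hx := hY (le_max_left (n x) (n y)) (hn x)
    have hy := hY (le_max_right (n x) (n y)) (hn y)
    rw [hagree _ _ hx, hagree _ _ hy, hagree _ _ (add_mem hx hy), ← map_add]
    rfl
  · rw [hagree _ _ ((Y (n x)).smul_mem r (hn x)), RingHom.id_apply, ← map_smul]
    rfl

theorem exists_linearMap_extending {P : Type*} [AddCommGroup P] [Module R P]
    (e : ∀ n, Y (n + 2) →ₗ[R] Y (n + 1))
    (he : ∀ n, e n ∘ₗ Submodule.inclusion (hY (Nat.le_add_right n 2)) =
      Submodule.inclusion (hY n.le_succ))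
    (φ : Y 1 →ₗ[R] P) :
    ∃ ψ : X →ₗ[R] P, ψ ∘ₗ (Y 0).subtype = φ ∘ₗ Submodule.inclusion (hY zero_le_one) := by
  let θ : ∀ n, Y (n + 1) →ₗ[R] P := fun n =>
    Nat.rec (motive := fun n => Y (n + 1) →ₗ[R] P) φ (fun n f => f ∘ₗ e n) n
  obtain ⟨ψ, hψ⟩ := exists_linearMap_of_monotone hY hex
    (fun n => θ n ∘ₗ Submodule.inclusion (hY n.le_succ))
    (fun n => congrArg (θ n ∘ₗ ·) (he n))
  exact ⟨ψ, hψ 0⟩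

variable {P : ℕ → Type*} [∀ n, AddCommGroup (P n)] [∀ n, Module R (P n)]
  (p : ∀ n, P n →ₗ[R] X) (hp : ∀ n, LinearMap.range (p n) ≤ Y (n + 1))

include hp

theorem exists_leftInverse_dfinsupp_of_approx (G : ∀ n, X →ₗ[R] P n)
    (hG : ∀ n, ∀ x ∈ Y n, p n (G n x) = x) :
    ∃ (i : X →ₗ[R] Π₀ n, P n) (q : (Π₀ n, P n) →ₗ[R] X), q ∘ₗ i = LinearMap.id := by
  let f : ℕ → X →ₗ[R] X := fun n => p n ∘ₗ G n
  -- Correcting `S n` by the error of the `n`-th approximation makes `S (n + 1)` agree with `S n` on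
  -- `Y n`, while `f (n + 1) ∘ f n = f n` gives `q ∘ S n = f n`.
  let S : ℕ → X →ₗ[R] Π₀ n, P n := fun n =>
    Nat.rec (DFinsupp.lsingle 0 ∘ₗ G 0)
      (fun n S => S + DFinsupp.lsingle (n + 1) ∘ₗ G (n + 1) ∘ₗ (LinearMap.id - f n)) n
  let q : (Π₀ n, P n) →ₗ[R] X := DFinsupp.lsum ℕ p
  have hS : ∀ n x, S (n + 1) x = S n x + DFinsupp.single (n + 1) (G (n + 1) (x - f n x)) :=
    fun n x => rfl
  have hq : ∀ n y, q (DFinsupp.single n y) = p n y := fun n y => by simp [q]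
  have hqS : ∀ n x, q (S n x) = f n x := by
    intro n x
    induction n with
    | zero => exact hq 0 (G 0 x)
    | succ n ih =>
      have hff : f (n + 1) (f n x) = f n x := hG _ _ (hp n ⟨_, rfl⟩)
      calc q (S (n + 1) x) = f n x + f (n + 1) (x - f n x) := by rw [hS, map_add, ih, hq]; rfl
        _ = f (n + 1) x := by rw [map_sub, hff, add_sub_cancel]
  obtain ⟨i, hi⟩ := exists_linearMap_of_monotone hY hex (fun n => S n ∘ₗ (Y n).subtype)
    (fun n => LinearMap.ext fun x => by
      change S (n + 1) x = S n x
      rw [hS, show f n x = x from hG n x x.2, sub_self, map_zero, DFinsupp.single_zero, add_zero])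
  refine ⟨i, q, LinearMap.ext fun x => ?_⟩
  obtain ⟨n, hn⟩ := hex x
  calc q (i x) = q (S n x) := congrArg q (LinearMap.congr_fun (hi n) ⟨x, hn⟩)
    _ = x := (hqS n x).trans (hG n x hn)

theorem exists_leftInverse_dfinsupp (g : ∀ n, Y (n + 2) →ₗ[R] P n)
    (hg : ∀ n, p n ∘ₗ g n ∘ₗ Submodule.inclusion (hY (Nat.le_add_right n 2)) = (Y n).subtype) :
    ∃ (i : X →ₗ[R] Π₀ n, P n) (q : (Π₀ n, P n) →ₗ[R] X), q ∘ₗ i = LinearMap.id := by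
  let e : ∀ n, Y (n + 2) →ₗ[R] Y (n + 1) := fun n =>
    (p n ∘ₗ g n).codRestrict (Y (n + 1)) fun y => hp n ⟨g n y, rfl⟩
  have he : ∀ n, e n ∘ₗ Submodule.inclusion (hY (Nat.le_add_right n 2)) =
      Submodule.inclusion (hY n.le_succ) := fun n =>
    LinearMap.ext fun x => Subtype.ext (LinearMap.congr_fun (hg n) x)
  choose G hG using fun n => exists_linearMap_extending (Y := fun j => Y (n + 1 + j))
    (fun _ _ hij => hY (by lia)) (fun x => (hex x).imp fun m hm => hY (by lia) hm)
    (fun j => e (n + 1 + j)) (fun j => he (n + 1 + j)) (g n)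
  refine exists_leftInverse_dfinsupp_of_approx hY hex p hp G fun n x hx => ?_
  have hGx : G n x = g n ⟨x, _⟩ := LinearMap.congr_fun (hG n) ⟨x, hY n.le_succ hx⟩
  rw [hGx]
  exact LinearMap.congr_fun (hg n) ⟨x, hx⟩

end Telescope

section LocalRetractions

/-- Every finitely generated `Y ≤ X` is a retract of a finite power of `M` up to extension to larger
finitely generated `Z`: there is `p : M ^ n → X` with a section over `Y` defined on each such `Z`.
Only the section may depend on `Z`; this is what is left of `X ∈ Add(M)` after faithfully flat
descent, and it suffices to recover it when `X` is countably generated. -/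
def HasLocalRetractions (R : Type*) [CommRing R] (M : Type*) [AddCommGroup M] [Module R M]
    (X : Type*) [AddCommGroup X] [Module R X] : Prop :=
  ∀ Y : Submodule R X, Y.FG → ∃ (n : ℕ) (p : (Fin n →₀ M) →ₗ[R] X),
    ∀ (Z : Submodule R X) (hYZ : Y ≤ Z), Z.FG →
      ∃ g : Z →ₗ[R] (Fin n →₀ M), p ∘ₗ g ∘ₗ Submodule.inclusion hYZ = Y.subtype

variable {R : Type*} [CommRing R] {M : Type*} [AddCommGroup M] [Module R M] [Module.Finite R M]
  {X : Type w} [AddCommGroup X] [Module R X]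

theorem MemAdd.hasLocalRetractions_of_baseChange [IsNoetherianRing R] (A : Type*) [CommRing A]
    [Algebra R A] [Module.FaithfullyFlat R A] {N : Type*} [AddCommGroup N] [Module A N]
    (hN : MemAdd A (A ⊗[R] M) N) (ψ : N ≃ₗ[A] A ⊗[R] X) : HasLocalRetractions R M X := by
  have hfp : ∀ {Y : Submodule R X}, Y.FG → Module.FinitePresentation R Y := fun hY =>
    have := Module.Finite.iff_fg.2 hY
    Module.finitePresentation_of_finite R _
  have := Module.finitePresentation_of_finite R M
  intro Y hY
  obtain ⟨n, p, g, hpg⟩ := hN.exists_factorization_of_baseChange A ψ hY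
  refine ⟨n, p, fun Z hYZ hZ => ?_⟩
  have := hfp hY
  have := hfp hZ
  refine exists_comp_comp_eq_of_baseChange A (g ∘ₗ Z.subtype.baseChange A) ?_
  rw [LinearMap.comp_assoc, ← LinearMap.baseChange_comp, Submodule.subtype_comp_inclusion, hpg]

theorem HasLocalRetractions.exists_chain (h : HasLocalRetractions R M X)
    (hX : IsCountablyGenerated R X) :
    ∃ (Y : ℕ → Submodule R X) (hY : Monotone Y) (k : ℕ → ℕ) (p : ∀ n, (Fin (k n) →₀ M) →ₗ[R] X),
      (∀ x, ∃ n, x ∈ Y n) ∧ (∀ n, LinearMap.range (p n) ≤ Y (n + 1)) ∧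
      ∀ n, ∃ g : Y (n + 2) →ₗ[R] (Fin (k n) →₀ M),
        p n ∘ₗ g ∘ₗ Submodule.inclusion (hY (Nat.le_add_right n 2)) = (Y n).subtype := by
  obtain ⟨s, hs⟩ := hX.exists_span_range_eq_top
  choose k p hp using fun Y : {Y : Submodule R X // Y.FG} => h Y Y.2
  have hnext : ∀ (n : ℕ) (Y : {Y : Submodule R X // Y.FG}),
      (Y.1 ⊔ R ∙ s n ⊔ LinearMap.range (p Y)).FG := fun n Y =>
    (Y.2.sup (Submodule.fg_span_singleton _)).sup (Module.Finite.iff_fg.1 inferInstance)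
  let Y : ℕ → {Y : Submodule R X // Y.FG} := fun n =>
    Nat.rec ⟨⊥, Submodule.fg_bot⟩ (fun n Y => ⟨_, hnext n Y⟩) n
  have hY : Monotone fun n => (Y n).1 :=
    monotone_nat_of_le_succ fun n => le_sup_of_le_left le_sup_left
  refine ⟨fun n => (Y n).1, hY, fun n => k (Y n), fun n => p (Y n), fun x => ?_,
    fun n => le_sup_right, fun n => hp (Y n) (Y (n + 2)) _ (Y (n + 2)).2⟩
  have hsup : (⊤ : Submodule R X) ≤ ⨆ n, (Y n).1 := by
    rw [← hs, Submodule.span_le]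
    rintro _ ⟨n, rfl⟩
    exact Submodule.mem_iSup_of_mem (n + 1) (Submodule.mem_sup_left
      (Submodule.mem_sup_right (Submodule.mem_span_singleton_self _)))
  exact (Submodule.mem_iSup_of_directed _ hY.directed_le).1 (hsup Submodule.mem_top)

theorem HasLocalRetractions.memAdd (h : HasLocalRetractions R M X)
    (hX : IsCountablyGenerated R X) : MemAdd R M X := by
  classical
  obtain ⟨Y, hY, k, p, hex, hp, hg⟩ := h.exists_chain hX
  choose g hg using hg
  obtain ⟨i, q, hqi⟩ := exists_leftInverse_dfinsupp hY hex p hp g hg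
  let E : ((Σ n, Fin (k n)) →₀ M) ≃ₗ[R] Π₀ n, Fin (k n) →₀ M := sigmaFinsuppLequivDFinsupp R
  refine memAdd_of_leftInverse (E.symm.toLinearMap ∘ₗ i) (q ∘ₗ E.toLinearMap) ?_
  ext x
  simpa using LinearMap.congr_fun hqi x

end LocalRetractions

section AnalyticPatching

variable {R : Type*} [CommRing R]

/-- `A` is analytically isomorphic to `R` along `S`: every `s ∈ S` is a nonzerodivisor on `A` and
`R / s R → A / s A` is bijective. These are the hypotheses under which modules over `R`, `A` and the
localizations at `S` can be patched. -/
structure IsAnalyticIsoAlong (S : Submonoid R) (A : Type*) [CommRing A] [Algebra R A] : Prop where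
  algebraMap_mem_nonZeroDivisors : ∀ s ∈ S, algebraMap R A s ∈ nonZeroDivisors A
  exists_eq_add_mul : ∀ s ∈ S, ∀ c : A, ∃ r b, c = algebraMap R A r + algebraMap R A s * b
  dvd_of_algebraMap_dvd : ∀ s ∈ S, ∀ r, algebraMap R A s ∣ algebraMap R A r → s ∣ r

/-- The saturation of a submodule `F` with respect to `S`: the elements with an `S`-multiple in `F`.
It is encoded as the preimage of the `S`-torsion of `N ⧸ F`. -/
def saturation {N : Type*} [AddCommGroup N] [Module R N] (S : Submonoid R) (F : Submodule R N) :
    Submodule R N :=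
  (Submodule.torsion' R (N ⧸ F) S).comap F.mkQ

theorem mem_saturation_iff {N : Type*} [AddCommGroup N] [Module R N] {S : Submonoid R}
    {F : Submodule R N} {n : N} : n ∈ saturation S F ↔ ∃ s ∈ S, s • n ∈ F := by
  simp only [saturation, Submodule.mem_comap, Submodule.mem_torsion'_iff, Submodule.mkQ_apply,
    Subtype.exists, Submonoid.mk_smul, exists_prop, ← Submodule.Quotient.mk_smul,
    Submodule.Quotient.mk_eq_zero]

theorem le_saturation {N : Type*} [AddCommGroup N] [Module R N] (S : Submonoid R)
    (F : Submodule R N) : F ≤ saturation S F := fun n hn =>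
  mem_saturation_iff.2 ⟨1, S.one_mem, by rwa [one_smul]⟩

theorem one_tmul_mem_span_image (A : Type*) [CommRing A] [Algebra R A] {X : Type*}
    [AddCommGroup X] [Module R X] {T : Set X} {x : X} (hx : x ∈ Submodule.span R T) :
    1 ⊗ₜ x ∈ Submodule.span A (TensorProduct.mk R A X 1 '' T) :=
  Submodule.span_subset_span R A _
    (Submodule.image_span_subset_span (TensorProduct.mk R A X 1) T ⟨x, hx, rfl⟩)

namespace IsAnalyticIsoAlong

variable {S : Submonoid R} {A : Type*} [CommRing A] [Algebra R A] (hA : IsAnalyticIsoAlong S A)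
  {N : Type*} [AddCommGroup N] [Module R N] [Module A N] [IsScalarTower R A N]

include hA

theorem exists_eq_add_smul_of_mem_span {s : R} (hs : s ∈ S) {T : Set N} {y : N}
    (hy : y ∈ Submodule.span A T) :
    ∃ f ∈ Submodule.span R T, ∃ y' ∈ Submodule.span A T, y = f + s • y' := by
  induction hy using Submodule.closure_induction with
  | zero => exact ⟨0, zero_mem _, 0, zero_mem _, by simp⟩
  | add y z _ _ hy hz =>
    obtain ⟨f, hf, y, hy, rfl⟩ := hy
    obtain ⟨g, hg, z, hz, rfl⟩ := hz
    exact ⟨f + g, add_mem hf hg, y + z, add_mem hy hz, by rw [smul_add]; abel⟩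
  | smul_mem c t ht =>
    obtain ⟨r, b, rfl⟩ := hA.exists_eq_add_mul s hs c
    refine ⟨r • t, Submodule.smul_mem _ r (Submodule.subset_span ht), b • t,
      Submodule.smul_mem _ b (Submodule.subset_span ht), ?_⟩
    rw [add_smul, mul_smul, algebraMap_smul, algebraMap_smul]

theorem mem_span_range_of_smul_mem {Λ : Type*} {e : Λ → N} (he : LinearIndependent A e) {s : R}
    (hs : s ∈ S) {y : N} (hy : y ∈ Submodule.span A (Set.range e))
    (hsy : s • y ∈ Submodule.span R (Set.range e)) : y ∈ Submodule.span R (Set.range e) := by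
  obtain ⟨d, rfl⟩ := Finsupp.mem_span_range_iff_exists_finsupp.1 hy
  obtain ⟨c, hc⟩ := Finsupp.mem_span_range_iff_exists_finsupp.1 hsy
  have hcoeff : c.mapRange (algebraMap R A) (map_zero _) = algebraMap R A s • d := by
    apply he
    rw [map_smul, Finsupp.linearCombination_apply, Finsupp.linearCombination_apply,
      Finsupp.sum_mapRange_index (by simp), algebraMap_smul, ← hc]
    simp only [algebraMap_smul]
  have hd : ∀ i, ∃ r, algebraMap R A r = d i := fun i => by
    have hi : algebraMap R A (c i) = algebraMap R A s * d i := DFunLike.congr_fun hcoeff i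
    obtain ⟨r, hr⟩ := hA.dvd_of_algebraMap_dvd s hs (c i) ⟨d i, hi⟩
    rw [hr, map_mul] at hi
    exact ⟨r, (mul_cancel_left_mem_nonZeroDivisors (hA.algebraMap_mem_nonZeroDivisors s hs)).1 hi⟩
  refine sum_mem fun i _ => ?_
  obtain ⟨r, hr⟩ := hd i
  simpa only [← hr, algebraMap_smul] using
    Submodule.smul_mem _ r (Submodule.subset_span (Set.mem_range_self i))

theorem exists_one_tmul_add_mem_span {X : Type*} [AddCommGroup X] [Module R X] {T : Set X}
    (hT : ∀ x, ∃ s ∈ S, s • x ∈ Submodule.span R T) (z : A ⊗[R] X) :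
    ∃ x : X, ∃ w ∈ Submodule.span A (TensorProduct.mk R A X 1 '' T), z = 1 ⊗ₜ x + w := by
  induction z with
  | zero => exact ⟨0, 0, zero_mem _, by simp⟩
  | add z z' hz hz' =>
    obtain ⟨x, w, hw, rfl⟩ := hz
    obtain ⟨x', w', hw', rfl⟩ := hz'
    exact ⟨x + x', w + w', add_mem hw hw', by rw [TensorProduct.tmul_add]; abel⟩
  | tmul c x =>
    obtain ⟨s, hs, hsx⟩ := hT x
    obtain ⟨r, b, rfl⟩ := hA.exists_eq_add_mul s hs c
    refine ⟨r • x, b • 1 ⊗ₜ (s • x), Submodule.smul_mem _ b (one_tmul_mem_span_image A hsx), ?_⟩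
    rw [TensorProduct.add_tmul, TensorProduct.smul_tmul', smul_eq_mul, mul_one,
      ← Algebra.smul_def, TensorProduct.smul_tmul, Algebra.algebraMap_eq_smul_one,
      TensorProduct.smul_tmul]

variable {Λ : Type*} {e : Λ → N}

theorem liftBaseChange_saturation_surjective
    (hN : ∀ n, ∃ s ∈ S, s • n ∈ Submodule.span A (Set.range e)) :
    Function.Surjective ((saturation S (Submodule.span R (Set.range e))).subtype.liftBaseChange A)
    := by
  set X := saturation S (Submodule.span R (Set.range e))
  set Φ := X.subtype.liftBaseChange A
  have hX : ∀ n ∈ X, n ∈ LinearMap.range Φ := fun n hn => ⟨1 ⊗ₜ ⟨n, hn⟩, by simp [Φ]⟩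
  intro n
  obtain ⟨s, hs, hsn⟩ := hN n
  obtain ⟨f, hf, y, hy, hfy⟩ := hA.exists_eq_add_smul_of_mem_span hs hsn
  have hny : n - y ∈ X := mem_saturation_iff.2 ⟨s, hs, by rwa [smul_sub, hfy, add_sub_cancel_right]⟩
  have hyΦ : Submodule.span A (Set.range e) ≤ LinearMap.range Φ :=
    Submodule.span_le.2 fun t ht => hX t (le_saturation S _ (Submodule.subset_span ht))
  rw [← sub_add_cancel n y]
  exact add_mem (hX _ hny) (hyΦ hy)

theorem liftBaseChange_saturation_injective (he : LinearIndependent A e) :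
    Function.Injective ((saturation S (Submodule.span R (Set.range e))).subtype.liftBaseChange A)
    := by
  set X := saturation S (Submodule.span R (Set.range e))
  set Φ := X.subtype.liftBaseChange A
  let e' : Λ → X := fun i => ⟨e i, le_saturation S _ (Submodule.subset_span ⟨i, rfl⟩)⟩
  have hΦ : ∀ x : X, Φ (1 ⊗ₜ x) = x := fun x => by simp [Φ]
  have hcomb : ∀ d : Λ →₀ A, Φ (Finsupp.linearCombination A (TensorProduct.mk R A X 1 ∘ e') d) =
      Finsupp.linearCombination A e d := fun d => by
    rw [Finsupp.apply_linearCombination]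
    exact congrArg (Finsupp.linearCombination A · d) (funext fun i => hΦ (e' i))
  have hspan : ∀ x : X, (x : N) ∈ Submodule.span R (Set.range e) →
      x ∈ Submodule.span R (Set.range e') := fun x hx => by
    rwa [← SetLike.mem_coe, ← X.injective_subtype.mem_set_image, ← Submodule.map_coe,
      Submodule.map_span, ← Set.range_comp]
  refine (injective_iff_map_eq_zero Φ).2 fun z hz => ?_
  obtain ⟨x, w, hw, rfl⟩ := hA.exists_one_tmul_add_mem_span (T := Set.range e')
    (fun x => (mem_saturation_iff.1 x.2).imp fun s hs => ⟨hs.1, hspan _ hs.2⟩) z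
  have hxF : x ∈ Submodule.span R (Set.range e') := by
    obtain ⟨s, hs, hsx⟩ := mem_saturation_iff.1 x.2
    refine hspan x (hA.mem_span_range_of_smul_mem he hs ?_ hsx)
    rw [← Set.range_comp, ← Finsupp.range_linearCombination] at hw
    obtain ⟨d, rfl⟩ := hw
    rw [← Finsupp.range_linearCombination]
    refine ⟨-d, ?_⟩
    rw [map_neg, ← hcomb, eq_comm, ← hΦ, ← add_eq_zero_iff_eq_neg, ← map_add, hz]
  have hz' := add_mem (one_tmul_mem_span_image A hxF) hw
  rw [← Set.range_comp, ← Finsupp.range_linearCombination] at hz'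
  obtain ⟨d, hd⟩ := hz'
  rw [← hd, hcomb] at hz
  rw [← hd, he (hz.trans (map_zero _).symm), map_zero]

theorem exists_linearEquiv_baseChange {N : Type w} [AddCommGroup N] [Module A N] {e : Λ → N}
    (he : LinearIndependent A e) (hN : ∀ n, ∃ s ∈ S,
      algebraMap R A s • n ∈ Submodule.span A (Set.range e)) :
    ∃ (X : Type w) (_ : AddCommGroup X) (_ : Module R X), Nonempty (N ≃ₗ[A] A ⊗[R] X) := by
  let _ : Module R N := Module.compHom N (algebraMap R A)
  have : IsScalarTower R A N := IsScalarTower.of_algebraMap_smul fun _ _ => rfl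
  exact ⟨_, _, _, ⟨(LinearEquiv.ofBijective _ ⟨hA.liftBaseChange_saturation_injective he,
    hA.liftBaseChange_saturation_surjective hN⟩).symm⟩⟩

end IsAnalyticIsoAlong

end AnalyticPatching

section LocalizedModule

variable {A : Type*} [CommRing A] {S : Submonoid A} (K : Type*) [CommRing K]
  [Algebra A K] [IsLocalization S K] {N N' : Type*} [AddCommGroup N] [Module A N]
  [AddCommGroup N'] [Module A N'] [Module K N'] [IsScalarTower A K N'] (f : N →ₗ[A] N')
  [IsLocalizedModule S f]

include S in
theorem exists_basis_eq_apply_of_isLocalizedModule {Λ : Type*} (b : Module.Basis Λ K N') :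
    ∃ (e : Λ → N) (b' : Module.Basis Λ K N'), ∀ i, b' i = f (e i) := by
  choose n hn using fun i => IsLocalizedModule.surj S f (b i)
  refine ⟨fun i => (n i).1, b.isUnitSMul fun i => IsLocalization.map_units K (n i).2, fun i => ?_⟩
  rw [Module.Basis.isUnitSMul_apply, algebraMap_smul, ← hn, Submonoid.smul_def]

theorem exists_smul_mem_of_apply_mem_span {T : Set N} {n : N}
    (hn : f n ∈ Submodule.span K (f '' T)) : ∃ s ∈ S, s • n ∈ Submodule.span A T := by
  rw [← Submodule.localized'_span K S f, Submodule.mem_localized'] at hn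
  obtain ⟨m, hm, s, hs⟩ := hn
  rw [IsLocalizedModule.mk'_eq_iff, ← LinearMap.map_smul_of_tower] at hs
  obtain ⟨t, ht⟩ := IsLocalizedModule.exists_of_eq (S := S) hs
  refine ⟨t * s, (t * s).2, ?_⟩
  rw [mul_smul]
  exact ht ▸ Submodule.smul_mem _ (t : A) hm

include f in
theorem exists_linearIndependent_of_basis_of_isLocalizedModule (hS : S ≤ nonZeroDivisors A)
    {Λ : Type*} (b : Module.Basis Λ K N') :
    ∃ e : Λ → N, LinearIndependent A e ∧
      ∀ n, ∃ s ∈ S, s • n ∈ Submodule.span A (Set.range e) := by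
  obtain ⟨e, b', hb'⟩ := exists_basis_eq_apply_of_isLocalizedModule (S := S) K f b
  have hfe : f ∘ e = b' := funext fun i => (hb' i).symm
  have : FaithfulSMul A K := (faithfulSMul_iff_algebraMap_injective A K).2
    (IsLocalization.injective K hS)
  refine ⟨e, LinearIndependent.of_comp f (hfe ▸ b'.linearIndependent.restrict_scalars' A),
    fun n => exists_smul_mem_of_apply_mem_span K f ?_⟩
  rw [← Set.range_comp, hfe, b'.span_eq]
  exact Submodule.mem_top

end LocalizedModule

section AdicCompletion

variable {R S : Type*} [CommRing R] [CommRing S]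

theorem exists_ringHom_adicCompletion (φ : S →+* R) (J : Ideal S) :
    ∃ g : AdicCompletion J S →+* AdicCompletion (J.map φ) R,
      g.comp (algebraMap S _) = (algebraMap R _).comp φ := by
  have hle : ∀ n, J ^ n ≤ (J.map φ ^ n).comap φ := fun n => by
    rw [← Ideal.map_le_iff_le_comap, Ideal.map_pow]
  let f : ∀ n, AdicCompletion J S →+* R ⧸ J.map φ ^ n := fun n =>
    (Ideal.quotientMap _ φ (hle n)).comp (AdicCompletion.evalₐ J n).toRingHom
  refine ⟨AdicCompletion.liftRingHom _ f fun {m n} hmn => ?_,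
    RingHom.ext fun s => AdicCompletion.ext_evalₐ fun n => ?_⟩
  · ext x
    obtain ⟨x, rfl⟩ := AdicCompletion.mk_surjective J S x
    calc _ = Ideal.Quotient.mk (J.map φ ^ m) (φ (x n)) := by simp [f]
      _ = Ideal.quotientMap _ φ (hle m) (Ideal.Quotient.mk (J ^ m) (x n)) := by simp
      _ = f m (AdicCompletion.mk J S x) := by simp [f, AdicCompletion.Ideal.mk_eq_mk J hmn]
  · rw [RingHom.comp_apply, AdicCompletion.evalₐ_liftRingHom]
    simp [f]

theorem exists_surjective_ringHom_adicCompletion {φ : S →+* R} (hφ : Function.Surjective φ)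
    {J : Ideal S} (hJ : J.FG) :
    ∃ g : AdicCompletion J S →+* AdicCompletion (J.map φ) R, Function.Surjective g := by
  obtain ⟨g, hg⟩ := exists_ringHom_adicCompletion φ J
  have hmap : (J.map (algebraMap S (AdicCompletion J S))).map g =
      (J.map φ).map (algebraMap R (AdicCompletion (J.map φ) R)) := by
    rw [Ideal.map_map, hg, Ideal.map_map]
  have : IsAdicComplete J (AdicCompletion J S) := AdicCompletion.isAdicComplete hJ
  have : IsAdicComplete (J.map φ) (AdicCompletion (J.map φ) R) :=
    AdicCompletion.isAdicComplete (hJ.map φ)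
  have : IsPrecomplete (J.map (algebraMap S (AdicCompletion J S))) (AdicCompletion J S) :=
    IsPrecomplete.map_algebraMap_iff.2 inferInstance
  have : IsHausdorff ((J.map (algebraMap S (AdicCompletion J S))).map g)
      (AdicCompletion (J.map φ) R) := by
    rw [hmap]
    exact IsHausdorff.map_algebraMap_iff.2 inferInstance
  refine ⟨g, surjective_of_mk_map_comp_surjective
    (I := J.map (algebraMap S (AdicCompletion J S))) g fun y => ?_⟩
  obtain ⟨y, rfl⟩ := Ideal.Quotient.mk_surjective y
  obtain ⟨r, hr⟩ := Ideal.Quotient.mk_surjective (AdicCompletion.evalOneₐ (J.map φ) y)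
  obtain ⟨s, rfl⟩ := hφ r
  refine ⟨algebraMap S _ s, ?_⟩
  rw [RingHom.comp_apply, Ideal.Quotient.mk_eq_mk_iff_sub_mem, hmap,
    ← AdicCompletion.ker_evalOneₐ_eq_map _ (hJ.map φ), ← RingHom.comp_apply g, hg]
  simp [RingHom.mem_ker, ← hr]

theorem isNoetherianRing_adicCompletion [IsNoetherianRing R] (I : Ideal R) :
    IsNoetherianRing (AdicCompletion I R) := by
  obtain ⟨T, rfl⟩ := IsNoetherian.noetherian I
  let φ : MvPolynomial T R →+* R := (MvPolynomial.aeval (fun t : T => (t : R))).toRingHom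
  have hφ : Function.Surjective φ := fun r => ⟨MvPolynomial.C r, by simp [φ]⟩
  have hmap : (MvPolynomial.idealOfVars T R).map φ = Ideal.span (T : Set R) := by
    rw [MvPolynomial.idealOfVars, Ideal.map_span, ← Set.range_comp]
    congr 1
    ext; simp [φ]
  obtain ⟨g, hg⟩ := exists_surjective_ringHom_adicCompletion hφ (MvPolynomial.idealOfVars_fg T R)
  have := isNoetherianRing_of_ringEquiv _
    (MvPowerSeries.toAdicCompletionAlgEquiv T R).toRingEquiv
  have := isNoetherianRing_of_surjective _ _ g hg
  rwa [hmap] at this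

end AdicCompletion

section LocalCompletion

open IsLocalRing nonZeroDivisors

theorem ringKrullDim_le_of_map_maximalIdeal_eq {R A : Type*} [CommRing R] [IsLocalRing R]
    [IsNoetherianRing R] [CommRing A] [IsLocalRing A] [IsNoetherianRing A] [Algebra R A]
    [IsLocalHom (algebraMap R A)] (h : (maximalIdeal R).map (algebraMap R A) = maximalIdeal A) :
    ringKrullDim A ≤ ringKrullDim R := by
  rw [← maximalIdeal_height_eq_ringKrullDim, ← maximalIdeal_height_eq_ringKrullDim]
  have : (maximalIdeal A).LiesOver (maximalIdeal R) := inferInstance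
  have hle := Ideal.height_le_height_add_of_liesOver (maximalIdeal R) (maximalIdeal A)
  rw [h, Ideal.map_quotient_self, Ideal.height_bot, add_zero] at hle
  exact WithBot.coe_le_coe.2 hle

theorem exists_pow_maximalIdeal_le_span_singleton {R : Type*} [CommRing R] [IsLocalRing R]
    [IsNoetherianRing R] [Ring.KrullDimLE 1 R] {s : R} (hs : s ∈ R⁰) :
    ∃ n, maximalIdeal R ^ n ≤ Ideal.span {s} := by
  refine Ideal.exists_pow_le_of_le_radical_of_fg ?_ (IsNoetherian.noetherian _)
  rw [Ideal.radical_eq_sInf]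
  refine le_sInf fun P ⟨hsP, hP⟩ => ?_
  have hPmax := (Ring.krullDimLE_one_iff.1 ‹_› P hP).resolve_left fun hPmin =>
    notMem_nonZeroDivisors_of_mem_mem_minimalPrimes
      (hsP (Ideal.mem_span_singleton_self s)) hPmin hs
  exact (eq_maximalIdeal hPmax).ge

theorem exists_eq_algebraMap_add_mul_of_pow_le_span {R : Type*} [CommRing R] {I : Ideal R}
    (hI : I.FG) {a : R} {n : ℕ} (hn : I ^ n ≤ Ideal.span {a}) (c : AdicCompletion I R) :
    ∃ r b, c = algebraMap R (AdicCompletion I R) r + algebraMap R (AdicCompletion I R) a * b := by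
  obtain ⟨r, hr⟩ := Submodule.Quotient.mk_surjective _ (AdicCompletion.eval I R n c)
  have hmem : c - algebraMap R (AdicCompletion I R) r ∈
      (I ^ n • ⊤ : Submodule R (AdicCompletion I R)) := by
    rw [AdicCompletion.pow_smul_top_eq_ker_eval hI, LinearMap.mem_ker, map_sub, ← hr, sub_eq_zero]
    rfl
  have hmem' := Submodule.smul_mono_left hn hmem
  rw [Submodule.ideal_span_singleton_smul, Submodule.mem_smul_pointwise_iff_exists] at hmem'
  obtain ⟨b, -, hb⟩ := hmem'
  exact ⟨r, b, by rw [← Algebra.smul_def, hb, add_sub_cancel]⟩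

theorem algebraMap_mem_nonZeroDivisors_of_flat {R A : Type*} [CommRing R] [CommRing A]
    [Algebra R A] [Module.Flat R A] {r : R} (hr : r ∈ R⁰) : algebraMap R A r ∈ A⁰ := by
  rw [mem_nonZeroDivisors_iff_right]
  intro y hy
  refine (Module.Flat.isSMulRegular_of_nonZeroDivisors hr).right_eq_zero_of_smul ?_
  rw [Algebra.smul_def, mul_comm, hy]

theorem dvd_of_algebraMap_dvd_of_faithfullyFlat {R A : Type*} [CommRing R] [CommRing A]
    [Algebra R A] [Module.FaithfullyFlat R A] {s r : R}
    (h : algebraMap R A s ∣ algebraMap R A r) : s ∣ r := by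
  rw [← Ideal.mem_span_singleton, ← Ideal.comap_map_eq_self_of_faithfullyFlat (B := A)
    (Ideal.span {s}), Ideal.mem_comap, Ideal.map_span, Set.image_singleton,
    Ideal.mem_span_singleton]
  exact h

variable {R : Type u} [CommRing R] [IsLocalRing R] [IsNoetherianRing R]

instance LocalCompletion.instFaithfullyFlat : Module.FaithfullyFlat R (LocalCompletion R) :=
  Module.FaithfullyFlat.of_flat_of_isLocalHom

instance LocalCompletion.instIsNoetherianRing : IsNoetherianRing (LocalCompletion R) :=
  isNoetherianRing_adicCompletion _

instance LocalCompletion.instKrullDimLE {n : ℕ} [Ring.KrullDimLE n R] :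
    Ring.KrullDimLE n (LocalCompletion R) :=
  Ring.krullDimLE_iff.2 <|
    (ringKrullDim_le_of_map_maximalIdeal_eq AdicCompletion.maximalIdeal_eq_map.symm).trans
      (Ring.krullDimLE_iff.1 ‹_›)

theorem LocalCompletion.isAnalyticIsoAlong [Ring.KrullDimLE 1 R] :
    IsAnalyticIsoAlong R⁰ (LocalCompletion R) where
  algebraMap_mem_nonZeroDivisors _ := algebraMap_mem_nonZeroDivisors_of_flat
  exists_eq_add_mul _ hs _ :=
    have ⟨_, hn⟩ := exists_pow_maximalIdeal_le_span_singleton hs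
    exists_eq_algebraMap_add_mul_of_pow_le_span (IsNoetherian.noetherian _) hn _
  dvd_of_algebraMap_dvd _ _ _ := dvd_of_algebraMap_dvd_of_faithfullyFlat

theorem LocalCompletion.exists_dvd_algebraMap [IsDomain R] [Ring.KrullDimLE 1 R]
    {s : LocalCompletion R} (hs : s ∈ (LocalCompletion R)⁰) :
    ∃ r ∈ R⁰, s ∣ algebraMap R (LocalCompletion R) r := by
  obtain hsu | hsm := em (IsUnit s)
  · exact ⟨1, one_mem _, hsu.dvd⟩
  rw [← mem_nonunits_iff, ← mem_maximalIdeal, AdicCompletion.maximalIdeal_eq_map] at hsm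
  have hm : maximalIdeal R ≠ ⊥ := fun hm => nonZeroDivisors.ne_zero hs <| by
    simpa only [hm, Ideal.map_bot, Ideal.mem_bot] using hsm
  obtain ⟨a, ham, ha⟩ := Submodule.exists_mem_ne_zero_of_ne_bot hm
  obtain ⟨n, hn⟩ := exists_pow_maximalIdeal_le_span_singleton hs
  refine ⟨a ^ n, mem_nonZeroDivisors_of_ne_zero (pow_ne_zero n ha), ?_⟩
  rw [map_pow, ← Ideal.mem_span_singleton]
  apply hn
  rw [AdicCompletion.maximalIdeal_eq_map]
  exact Ideal.pow_mem_pow (Ideal.mem_map_of_mem _ ham) n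

end LocalCompletion

section ExtendedModules

open nonZeroDivisors

theorem free_baseChange_of_isUnit_algebraMap {R K : Type*} [CommRing R] [IsDomain R] [CommRing K]
    [Algebra R K] (hK : ∀ r : R⁰, IsUnit (algebraMap R K r)) (X : Type*) [AddCommGroup X]
    [Module R X] : Module.Free K (K ⊗[R] X) := by
  let Q := FractionRing R
  let _ : Algebra Q K := (IsLocalization.lift (M := R⁰) hK).toAlgebra
  have : IsScalarTower R Q K :=
    .of_algebraMap_eq fun r => (IsLocalization.lift_eq hK r).symm
  exact .of_equiv (TensorProduct.AlgebraTensorModule.cancelBaseChange R Q K K X)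

theorem free_fractionRing_baseChange_of_flat {R : Type*} [CommRing R] [IsDomain R] (A : Type*)
    [CommRing A] [Algebra R A] [Module.Flat R A] (X : Type*) [AddCommGroup X] [Module R X] :
    Module.Free (FractionRing A) (FractionRing A ⊗[A] (A ⊗[R] X)) := by
  have hunit (r : R⁰) : IsUnit (algebraMap R (FractionRing A) r) := by
    rw [IsScalarTower.algebraMap_apply R A]
    exact IsLocalization.map_units _
      (⟨_, algebraMap_mem_nonZeroDivisors_of_flat r.2⟩ : A⁰)
  have := free_baseChange_of_isUnit_algebraMap hunit X
  exact .of_equiv (TensorProduct.AlgebraTensorModule.cancelBaseChange R A (FractionRing A)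
    (FractionRing A) X).symm

variable {R : Type u} [CommRing R] [IsLocalRing R]
  {N : Type w} [AddCommGroup N] [Module (LocalCompletion R) N]
  {X : Type*} [AddCommGroup X] [Module R X]

theorem IsExtendedFrom.congr (h : IsExtendedFrom R N X) {X' : Type*} [AddCommGroup X']
    [Module R X'] (e : X ≃ₗ[R] X') : IsExtendedFrom R N X' :=
  h.map fun ψ => ψ ≪≫ₗ e.baseChange R (LocalCompletion R)

variable [IsNoetherianRing R]

theorem IsExtendedFrom.free_fractionRing [IsDomain R] (h : IsExtendedFrom R N X) :
    Module.Free (FractionRing (LocalCompletion R))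
      (FractionRing (LocalCompletion R) ⊗[LocalCompletion R] N) :=
  have := free_fractionRing_baseChange_of_flat (R := R) (LocalCompletion R) X
  have ⟨ψ⟩ := h
  .of_equiv (ψ.symm.baseChange _ (FractionRing (LocalCompletion R)))

theorem IsExtendedFrom.isCountablyGenerated (h : IsExtendedFrom R N X)
    (hN : IsCountablyGenerated (LocalCompletion R) N) : IsCountablyGenerated R X :=
  have ⟨ψ⟩ := h
  (hN.of_surjective ψ.toLinearMap ψ.surjective).of_baseChange

theorem IsExtendedFrom.memAdd (h : IsExtendedFrom R N X)
    (hNcg : IsCountablyGenerated (LocalCompletion R) N) {M : Type*} [AddCommGroup M] [Module R M]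
    [Module.Finite R M] (hN : MemAdd (LocalCompletion R) (LocalCompletion R ⊗[R] M) N) :
    MemAdd R M X :=
  have ⟨ψ⟩ := h
  (hN.hasLocalRetractions_of_baseChange _ ψ).memAdd (h.isCountablyGenerated hNcg)

theorem exists_isExtendedFrom_of_basis [IsDomain R] [Ring.KrullDimLE 1 R] {Λ : Type*}
    (b : Module.Basis Λ (FractionRing (LocalCompletion R))
      (FractionRing (LocalCompletion R) ⊗[LocalCompletion R] N)) :
    ∃ (X : Type w) (_ : AddCommGroup X) (_ : Module R X), IsExtendedFrom R N X := by
  have := (isLocalizedModule_iff_isBaseChange (LocalCompletion R)⁰ _ _).2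
    (TensorProduct.isBaseChange (LocalCompletion R) N (FractionRing (LocalCompletion R)))
  obtain ⟨e, he, hspan⟩ := exists_linearIndependent_of_basis_of_isLocalizedModule
    (FractionRing (LocalCompletion R))
    (TensorProduct.mk (LocalCompletion R) (FractionRing (LocalCompletion R)) N 1) le_rfl b
  refine LocalCompletion.isAnalyticIsoAlong.exists_linearEquiv_baseChange he fun n => ?_
  obtain ⟨s, hs, hsn⟩ := hspan n
  obtain ⟨r, hr, t, hrt⟩ := LocalCompletion.exists_dvd_algebraMap hs
  refine ⟨r, hr, ?_⟩
  rw [hrt, mul_comm, mul_smul]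
  exact Submodule.smul_mem _ t hsn

end ExtendedModules

theorem mainTheorem1_general
    (R : Type u) [CommRing R] [IsDomain R] [IsLocalRing R] [IsNoetherianRing R]
    [Ring.KrullDimLE 1 R]
    (M : Type v) [AddCommGroup M] [Module R M] [Module.Finite R M]
    (N : Type w) [AddCommGroup N] [Module (LocalCompletion R) N]
    (hNcg : IsCountablyGenerated (LocalCompletion R) N)
    (hN : MemAdd (LocalCompletion R) (LocalCompletion R ⊗[R] M) N) :
    List.TFAE [
      ∃ (X : Type (max u x)) (_ : AddCommGroup X) (_ : Module R X), IsExtendedFrom R N X,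
      ∃ Λ : Type, Countable Λ ∧
        Nonempty ((FractionRing (LocalCompletion R) ⊗[LocalCompletion R] N)
          ≃ₗ[FractionRing (LocalCompletion R)] (Λ →₀ FractionRing (LocalCompletion R))),
      ∃ (X : Type (max u x)) (_ : AddCommGroup X) (_ : Module R X),
        IsCountablyGenerated R X ∧ MemAdd R M X ∧ IsExtendedFrom R N X] := by
  tfae_have 1 → 2 := fun ⟨_, _, _, hX⟩ =>
    have := hX.free_fractionRing
    (hNcg.baseChange _).exists_countable_linearEquiv_finsupp
  tfae_have 2 → 3 := by
    rintro ⟨Λ, -, ⟨φ⟩⟩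
    obtain ⟨X, _, _, hX⟩ := exists_isExtendedFrom_of_basis (.ofRepr φ)
    obtain ⟨X', _, _, ⟨e⟩⟩ :=
      IsCountablyGenerated.exists_linearEquiv.{u, x} (hX.isCountablyGenerated hNcg)
    have hX' := hX.congr e
    exact ⟨X', _, _, hX'.isCountablyGenerated hNcg, hX'.memAdd hNcg hN, hX'⟩
  tfae_have 3 → 1 := fun ⟨X, _, _, _, _, hX⟩ => ⟨X, _, _, hX⟩
  tfae_finish

theorem mainTheorem1
    (R : Type u) [CommRing R] [IsDomain R] [IsLocalRing R] [IsNoetherianRing R]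
    (hdim : ringKrullDim R = 1)
    (hred : IsReduced (LocalCompletion R))
    (M : Type v) [AddCommGroup M] [Module R M] [Module.Finite R M] [Module.IsTorsionFree R M]
    (N : Type w) [AddCommGroup N] [Module (LocalCompletion R) N]
    (hNcg : IsCountablyGenerated (LocalCompletion R) N)
    (hN : MemAdd (LocalCompletion R) (LocalCompletion R ⊗[R] M) N) :
    List.TFAE [
      ∃ (X : Type (max u x)) (_ : AddCommGroup X) (_ : Module R X), IsExtendedFrom R N X,
      ∃ Λ : Type, Countable Λ ∧
        Nonempty ((FractionRing (LocalCompletion R) ⊗[LocalCompletion R] N)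
          ≃ₗ[FractionRing (LocalCompletion R)] (Λ →₀ FractionRing (LocalCompletion R))),
      ∃ (X : Type (max u x)) (_ : AddCommGroup X) (_ : Module R X),
        IsCountablyGenerated R X ∧ MemAdd R M X ∧ IsExtendedFrom R N X] := by
  have : Ring.KrullDimLE 1 R := Ring.krullDimLE_iff.2 hdim.le
  exact mainTheorem1_general R M N hNcg hN
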